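/- Let $p$ be an odd prime and let $\gamma$ be a $p$-core. Let $\mathfrak B_\gamma$ be the set of partitions with $p$-core $\gamma$ and $p$-weight $2$, that is, the partitions from which $\gamma$ is obtained by successively removing two rim hooks of length $p$. The abacus of a partition $\lambda$ has beads at the positions $\lambda_m-m$, $m\ge 1$, and its runners are the residue classes modulo $p$. Let $\rho_0<\rho_1<\dots<\rho_{p-1}$ be the largest bead positions of $\gamma$ on the $p$ runners, and call the runner of $\rho_i$ runner $i$. The pyramid of $\gamma$ is the array with entries ${}_i\gamma_j$, $0\le i\le j\le p-1$, where ${}_i\gamma_j=1$ if $\rho_j-\rho_i<p$ and ${}_i\gamma_j=0$ otherwise; put also ${}_i\gamma_j=1$ for $i>j$, and ${}_i\gamma_j=0$ for $i\le j$ and $j\ge p$. Denote by $\langle i,j\rangle$ ($i<j$) the partition whose abacus is obtained from that of $\gamma$ by moving the beads at $\rho_i$ and $\rho_j$ to $\rho_i+p$ and $\rho_j+p$; by $\langle i\rangle$ the one obtained by moving the bead at $\rho_i$ to $\rho_i+2p$; and by $\langle i^2\rangle$ the one obtained by moving the beads at $\rho_i$ and $\rho_i-p$ to $\rho_i+p$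 and $\rho_i$. For $0\le i\le j<p$ with $i<p-1$ put $$\lceil i,j\rfloor=\begin{cases}\langle i+1\rangle & i=j,\ {}_{i+1}\gamma_{i+2}=0,\\ \langle i+1,i+2\rangle & i=j,\ {}_{i+1}\gamma_{i+2}=1,\\ \langle i+1,j\rangle & i\ne j,\ {}_{i+1}\gamma_j=0,\\ \langle j^2\rangle & i\ne j,\ {}_{i+1}\gamma_j=1,\ {}_i\gamma_j=0,\\ \langle i\rangle & i\neq j,\ {}_i\gamma_j=1,\ {}_i\gamma_{j+1}=0,\\ \langle i,j+1\rangle & i\ne j,\ {}_i\gamma_{j+1}=1.\end{cases}$$ These are the $p$-regular partitions in $\mathfrak B_\gamma$; $\lceil i,j\rfloor$ is placed at the entry ${}_i\gamma_j$ of the pyramid, in row $j-i$, and $\lceil i,j\rfloor$ is to the left of $\lceil k,l\rfloor$ if $i+j<k+l$. Let $\lambda=\lceil i,j\rfloor$ and $\tau=\lceil k,l\rfloor$ be $p$-regular partitions in $\mathfrak B_\gamma$ such that $\lambda$ is to the left of $\tau$ in the pyramid. Assume that $\lambda$ is not in row $0$ (that is, $i<j$), or that $\lambda$ and $\tau$ are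 both in row $0$ (that is, $i=j$ and $k=l$). Then $\tau$ is not strictly dominated by $\lambda$, i.e. $\tau\ntriangleleft\lambda$; equivalently, either $\lambda\trianglelefteq\tau$, or $\lambda$ and $\tau$ are incomparable in the dominance order. -/

import Mathlib

/-! Partitions are Young diagrams in English convention; rows and columns are indexed from `0`,
so the part `λ_{i+1}` of the partition `λ` is `lam.rowLen i`. -/

namespace WeightTwo

/-- The dominance order `lam ⊴ mu`. -/
def DominatedBy (lam mu : YoungDiagram) : Prop :=
  ∀ k : ℕ, ∑ i ∈ Finset.range k, lam.rowLen i ≤ ∑ i ∈ Finset.range k, mu.rowLen i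

infix:50 " ⊴ᵈ " => DominatedBy

/-- The strict dominance order `lam ◁ mu`. -/
def StrictlyDominatedBy (lam mu : YoungDiagram) : Prop :=
  lam ⊴ᵈ mu ∧ lam ≠ mu

infix:50 " ◁ᵈ " => StrictlyDominatedBy

/-- `lam` is `p`-regular: no nonzero part is repeated `p` or more times
(`rowLens` is the list of the nonzero parts). -/
def IsPRegular (p : ℕ) (lam : YoungDiagram) : Prop :=
  ∀ m ∈ lam.rowLens, lam.rowLens.count m < p

/-- The hook of the node `c`: the node, its arm and its leg. -/
def hook (lam : YoungDiagram) (c : ℕ × ℕ) : Finset (ℕ × ℕ) :=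
  lam.cells.filter fun d => (d.1 = c.1 ∧ c.2 ≤ d.2) ∨ (d.2 = c.2 ∧ c.1 ≤ d.1)

/-- The rim hook of the node `c`: the part of the rim which runs from the last node of the row
of `c` down to the last node of the column of `c`. -/
def rimHook (lam : YoungDiagram) (c : ℕ × ℕ) : Finset (ℕ × ℕ) :=
  lam.cells.filter fun d => (d.1 + 1, d.2 + 1) ∉ lam ∧ c.1 ≤ d.1 ∧ c.2 ≤ d.2

/-- `mu` is obtained from `lam` by removing one rim hook of length `p`. -/
def RemovesRimHook (p : ℕ) (lam mu : YoungDiagram) : Prop :=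
  ∃ c ∈ lam, (hook lam c).card = p ∧ mu.cells = lam.cells \ rimHook lam c

/-- `mu` is obtained from `lam` by successively removing `w` rim hooks of length `p`. -/
def RemovesRimHooks (p : ℕ) : ℕ → YoungDiagram → YoungDiagram → Prop
  | 0, lam, mu => lam = mu
  | w + 1, lam, mu => ∃ nu, RemovesRimHook p lam nu ∧ RemovesRimHooks p w nu mu

/-- A `p`-core: a partition without hooks (equivalently rim hooks) of length `p`. -/
def IsCore (p : ℕ) (gam : YoungDiagram) : Prop :=
  ∀ c ∈ gam, (hook gam c).card ≠ p

/-- The partitions of the block of weight `w` with core `gam`: those with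
`p`-core `gam` and `p`-weight `w`. -/
def block (p : ℕ) (gam : YoungDiagram) (w : ℕ) : Set YoungDiagram :=
  {lam | IsCore p gam ∧ RemovesRimHooks p w lam gam}

/-- The `p`-regular partitions of the block of weight `w` with core `gam`. -/
def regularBlock (p : ℕ) (gam : YoungDiagram) (w : ℕ) : Set YoungDiagram :=
  {lam | lam ∈ block p gam w ∧ IsPRegular p lam}

/-- The beta-numbers `λ_i - i`, `i ≥ 1`: the positions of the beads on the abacus. -/
def beads (lam : YoungDiagram) : Set ℤ :=
  {x | ∃ i : ℕ, x = (lam.rowLen i : ℤ) - (i + 1)}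

/-- The position of the lowest bead on the runner of the positions congruent to `r` modulo `p`
(lower on the abacus means a larger integer). -/
noncomputable def lowestBead (p : ℕ) (gam : YoungDiagram) (r : Fin p) : ℤ :=
  sSup {x | x ∈ beads gam ∧ x ≡ (r : ℕ) [ZMOD p]}

/-- The positions `ρ_0 < ρ_1 < ⋯ < ρ_{p-1}` of the lowest beads of the `p` runners, in increasing
order. The value at an index `k ≥ p` is irrelevant. -/
noncomputable def rho (p : ℕ) (gam : YoungDiagram) (k : ℕ) : ℤ :=
  if h : k < p then lowestBead p gam (Tuple.sort (lowestBead p gam) ⟨k, h⟩) else 0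

/-- The entry with indices `i`, `j` of the pyramid of `gam`, extended by `1` below the pyramid and
by `0` on its upper right side. -/
noncomputable def pyramid (p : ℕ) (gam : YoungDiagram) (i j : ℕ) : ℕ :=
  if j < i then 1
  else if p ≤ j then 0
  else if rho p gam j - rho p gam i < p then 1
  else 0

/-- The three kinds of names `⟨i,j⟩`, `⟨i⟩`, `⟨i²⟩` of partitions in a block of weight two;
here `i` and `j` are labels of runners in the order given by `rho`. -/
inductive Name where
  | pair (i j : ℕ)
  | single (i : ℕ)
  | square (i : ℕ)

/-- The abacus of the partition with the given name, obtained from the abacus of the core: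
`⟨i,j⟩` moves the lowest beads of the runners `i` and `j` one position down, `⟨i⟩` moves the
lowest bead of the runner `i` two positions down, `⟨i²⟩` moves the lowest bead of the runner `i`
and the bead just above it one position down each. -/
noncomputable def Name.beads (p : ℕ) (gam : YoungDiagram) : Name → Set ℤ
  | .pair i j => (WeightTwo.beads gam \ {rho p gam i, rho p gam j}) ∪
      {rho p gam i + p, rho p gam j + p}
  | .single i => (WeightTwo.beads gam \ {rho p gam i}) ∪ {rho p gam i + 2 * p}
  | .square i => (WeightTwo.beads gam \ {rho p gam i, rho p gam i - p}) ∪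
      {rho p gam i + p, rho p gam i}

/-- The name of the `p`-regular partition `⌈i,j⌋`, for `0 ≤ i ≤ j < p` and `i < p - 1`. -/
noncomputable def regularName (p : ℕ) (gam : YoungDiagram) (i j : ℕ) : Name :=
  if i = j then
    if pyramid p gam (i + 1) (i + 2) = 0 then .single (i + 1) else .pair (i + 1) (i + 2)
  else if pyramid p gam (i + 1) j = 0 then .pair (i + 1) j
  else if pyramid p gam i j = 0 then .square j
  else if pyramid p gam i (j + 1) = 0 then .single i
  else .pair i (j + 1)

/-- `lam` is the partition `⌈i,j⌋`, that is, it occupies the place of the entry with indices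
`i`, `j` in the pyramid of `gam`. This entry lies in row `j - i` and in the column of the entries
with the same value of `i + j`, columns being ordered from left to right by this value. -/
def HasPosition (p : ℕ) (gam lam : YoungDiagram) (i j : ℕ) : Prop :=
  i ≤ j ∧ j < p ∧ i + 1 < p ∧ beads lam = (regularName p gam i j).beads p gam

end WeightTwo

open WeightTwo

namespace WeightTwo

/-! Each named partition arises from the core by two moves `a → a + p` and `b → b + p` with `a ≤ b`;
a double move on one runner counts as two. Dominance is majorization of bead positions, so it bounds
the sums of `max (x - t) 0` over the beads for every `t`. The core contributes equally to both
sides, and suitable `t` yield `c ≤ a` and `d ≤ b` when the partition with moves `c ≤ d` is dominated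
by the one with moves `a ≤ b` (`IsShift.le_of_dominatedBy`). The pyramid entries locate the moves of
`⌈i,j⌋` relative to `rho` (`HasPosition.exists_isShift`). Together these bounds nearly force `k + l
≤ i + j`; the borderline cases would put two of the positions `rho` at distance exactly `p`, hence
on the same runner. -/

/-! ### Bead positions and sums over them -/

/-- The `i`-th largest bead position of `lam`, counting from `0`. -/
def bead (lam : YoungDiagram) (i : ℕ) : ℤ := (lam.rowLen i : ℤ) - (i + 1)

theorem mem_beads {lam : YoungDiagram} {x : ℤ} : x ∈ beads lam ↔ ∃ i, bead lam i = x := by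
  simp only [beads, bead, Set.mem_ofPred_eq, eq_comm]

theorem bead_strictAnti (lam : YoungDiagram) : StrictAnti (bead lam) := by
  intro i j hij
  have := lam.rowLen_anti i j hij.le
  simp only [bead]
  omega

theorem le_of_mem_beads {lam : YoungDiagram} {x : ℤ} (hx : x ∈ beads lam) :
    x ≤ lam.rowLen 0 := by
  obtain ⟨i, rfl⟩ := mem_beads.1 hx
  have := lam.rowLen_anti 0 i (Nat.zero_le i)
  simp only [bead]
  omega

theorem rowLen_eq_zero_of_le {lam : YoungDiagram} {i : ℕ} (h : lam.colLen 0 ≤ i) :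
    lam.rowLen i = 0 := by
  by_contra hne
  have : (i, 0) ∈ lam := YoungDiagram.mem_iff_lt_rowLen.2 (Nat.pos_of_ne_zero hne)
  have := YoungDiagram.mem_iff_lt_colLen.1 this
  omega

/-- Far enough up the abacus, all positions are occupied. -/
theorem mem_beads_of_lt {lam : YoungDiagram} {x : ℤ} (hx : x < -(lam.colLen 0 : ℤ)) :
    x ∈ beads lam := by
  refine mem_beads.2 ⟨(-x - 1).toNat, ?_⟩
  rw [bead, rowLen_eq_zero_of_le (by omega)]
  omega

/-- A sum over the beads of `lam` below the position `t` can be taken over the positions of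
an interval. -/
theorem sum_bead_eq_sum_indicator (lam : YoungDiagram) (f : ℤ → ℤ) {t M : ℤ} {N : ℕ}
    (hf : ∀ x ≤ t, f x = 0) (hM : ∀ x ∈ beads lam, x ≤ M) (hN : ∀ i, N ≤ i → bead lam i ≤ t) :
    ∑ i ∈ Finset.range N, f (bead lam i) =
      ∑ x ∈ Finset.Icc (t + 1) M, (beads lam).indicator f x := by
  classical
  have himage : ∑ i ∈ Finset.range N, f (bead lam i) =
      ∑ x ∈ (Finset.range N).image (bead lam), f x :=
    (Finset.sum_image fun _ _ _ _ h => (bead_strictAnti lam).injective h).symm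
  have hfilter : ∑ x ∈ Finset.Icc (t + 1) M, (beads lam).indicator f x =
      ∑ x ∈ (Finset.Icc (t + 1) M).filter (· ∈ beads lam), f x := by
    rw [Finset.sum_filter]
    rfl
  rw [himage, hfilter]
  symm
  apply Finset.sum_subset
  · intro x hx
    obtain ⟨hx, hmem⟩ := Finset.mem_filter.1 hx
    obtain ⟨i, rfl⟩ := mem_beads.1 hmem
    refine Finset.mem_image_of_mem _ (Finset.mem_range.2 ?_)
    by_contra hi
    have := hN i (not_lt.1 hi)
    have := (Finset.mem_Icc.1 hx).1
    omega
  · intro x hx hnot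
    obtain ⟨i, -, rfl⟩ := Finset.mem_image.1 hx
    have hmem : bead lam i ∈ beads lam := mem_beads.2 ⟨i, rfl⟩
    apply hf
    by_contra hlt
    exact hnot (Finset.mem_filter.2
      ⟨Finset.mem_Icc.2 ⟨by omega, hM _ hmem⟩, hmem⟩)

/-! ### Dominance as majorization of beads -/

/-- The positive terms of an antitone sequence form an initial segment. -/
theorem exists_sum_max_zero_eq (u : ℕ → ℤ) (hu : Antitone u) (N : ℕ) :
    ∃ k ≤ N, ∑ i ∈ Finset.range N, max (u i) 0 = ∑ i ∈ Finset.range k, u i := by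
  induction N with
  | zero => exact ⟨0, le_rfl, rfl⟩
  | succ n ih =>
    rcases le_or_gt (u n) 0 with h | h
    · obtain ⟨k, hk, hsum⟩ := ih
      exact ⟨k, by omega, by rw [Finset.sum_range_succ, max_eq_right h, hsum, add_zero]⟩
    · refine ⟨n + 1, le_rfl, Finset.sum_congr rfl fun i hi => max_eq_left ?_⟩
      exact h.le.trans (hu (Nat.lt_succ_iff.1 (Finset.mem_range.1 hi)))

/-- Replaces partial sums of sorted beads by sums that depend only on the set of beads, so that
common beads can cancel. -/
theorem DominatedBy.sum_max_bead_le {tau lam : YoungDiagram} (h : tau ⊴ᵈ lam) (t : ℤ) (N : ℕ) :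
    ∑ i ∈ Finset.range N, max (bead tau i - t) 0 ≤
      ∑ i ∈ Finset.range N, max (bead lam i - t) 0 := by
  obtain ⟨k, hk, hsum⟩ := exists_sum_max_zero_eq (fun i => bead tau i - t)
    (fun _ _ hij => sub_le_sub_right ((bead_strictAnti tau).antitone hij) t) N
  rw [hsum]
  calc ∑ i ∈ Finset.range k, (bead tau i - t)
      ≤ ∑ i ∈ Finset.range k, (bead lam i - t) := by
        have hk : ((∑ i ∈ Finset.range k, tau.rowLen i : ℕ) : ℤ) ≤
          ((∑ i ∈ Finset.range k, lam.rowLen i : ℕ) : ℤ) := by exact_mod_cast h k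
        push_cast at hk
        simp only [bead, Finset.sum_sub_distrib]
        linarith
    _ ≤ ∑ i ∈ Finset.range k, max (bead lam i - t) 0 :=
        Finset.sum_le_sum fun i _ => le_max_left _ _
    _ ≤ ∑ i ∈ Finset.range N, max (bead lam i - t) 0 :=
        Finset.sum_le_sum_of_subset_of_nonneg (Finset.range_mono hk)
          fun i _ _ => le_max_right _ _

/-! ### Comparing two pairs of moves -/

/-- The abacus of `lam` arises from that of `gam` by moving a bead from `a` to `a + p` and a bead
from `b` to `b + p`, in the sense of an identity between indicator functions (so that one of the
two moves may use the position vacated or filled by the other one). -/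
def IsShift (p : ℕ) (gam lam : YoungDiagram) (a b : ℤ) : Prop :=
  ∀ (f : ℤ → ℤ) (x : ℤ), (beads lam).indicator f x =
    (beads gam).indicator f x - (if x = a then f a else 0) - (if x = b then f b else 0) +
      (if x = a + p then f (a + p) else 0) + (if x = b + p then f (b + p) else 0)

theorem IsShift.sum_indicator {p : ℕ} {gam lam : YoungDiagram} {a b : ℤ}
    (h : IsShift p gam lam a b) (f : ℤ → ℤ) {t M : ℤ} (hf : ∀ x ≤ t, f x = 0)
    (ha : a + p ≤ M) (hb : b + p ≤ M) :
    ∑ x ∈ Finset.Icc (t + 1) M, (beads lam).indicator f x =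
      ∑ x ∈ Finset.Icc (t + 1) M, (beads gam).indicator f x +
        (f (a + p) - f a) + (f (b + p) - f b) := by
  have hpoint : ∀ y ≤ M, ∑ x ∈ Finset.Icc (t + 1) M, (if x = y then f y else 0) = f y := by
    intro y hy
    rw [Finset.sum_ite_eq' (Finset.Icc (t + 1) M) y fun _ => f y]
    split_ifs with hmem
    · rfl
    · rw [Finset.mem_Icc] at hmem
      exact (hf y (by omega)).symm
  simp only [h f, Finset.sum_add_distrib, Finset.sum_sub_distrib]
  rw [hpoint a (by omega), hpoint b (by omega), hpoint _ ha, hpoint _ hb]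
  ring

/-- Dominance between partitions obtained from `gam` by two moves implies the componentwise order
on the starting positions of the moves. -/
theorem IsShift.le_of_dominatedBy {p : ℕ} (hp : 0 < p) {gam lam tau : YoungDiagram}
    {a b c d : ℤ} (hlam : IsShift p gam lam a b) (htau : IsShift p gam tau c d)
    (hab : a ≤ b) (hcd : c ≤ d) (h : tau ⊴ᵈ lam) : c ≤ a ∧ d ≤ b := by
  have key : ∀ t : ℤ, max (c + p - t) 0 - max (c - t) 0 + (max (d + p - t) 0 - max (d - t) 0) ≤
      max (a + p - t) 0 - max (a - t) 0 + (max (b + p - t) 0 - max (b - t) 0) := by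
    intro t
    obtain ⟨M, hM⟩ : ∃ M : ℤ, (lam.rowLen 0 : ℤ) ≤ M ∧ (tau.rowLen 0 : ℤ) ≤ M ∧
        b + p ≤ M ∧ d + p ≤ M :=
      ⟨lam.rowLen 0 + tau.rowLen 0 + |b + p| + |d + p|, by
        have := le_abs_self (b + p); have := le_abs_self (d + p)
        have := abs_nonneg (b + p); have := abs_nonneg (d + p)
        refine ⟨?_, ?_, ?_, ?_⟩ <;> omega⟩
    have hN : ∀ nu : YoungDiagram, (nu.rowLen 0 : ℤ) ≤ M →
        ∀ i, (M - t).toNat ≤ i → bead nu i ≤ t := by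
      intro nu hnu i hi
      have := nu.rowLen_anti 0 i (Nat.zero_le i)
      simp only [bead]
      omega
    have hf : ∀ x ≤ t, (fun x => max (x - t) 0) x = 0 := fun x hx => max_eq_right (by omega)
    have hsum := h.sum_max_bead_le t (M - t).toNat
    rw [sum_bead_eq_sum_indicator tau (fun x => max (x - t) 0) hf
        (fun x hx => (le_of_mem_beads hx).trans hM.2.1) (hN tau hM.2.1),
      sum_bead_eq_sum_indicator lam (fun x => max (x - t) 0) hf
        (fun x hx => (le_of_mem_beads hx).trans hM.1) (hN lam hM.1),
      hlam.sum_indicator _ hf (by omega) (by omega),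
      htau.sum_indicator _ hf (by omega) (by omega)] at hsum
    linarith
  constructor
  -- At `t = c` the left side is `2 * p`, while each move on the right gains at most `p`, and gains
  -- `p` only if it starts at or beyond `t`.
  · have := key c
    omega
  -- At `t = b + p` the right side vanishes, so no move on the left may end beyond `t`.
  · have := key (b + p)
    omega

/-! ### Lowest beads of the runners -/

theorem lowestBead_isGreatest {p : ℕ} (hp : 0 < p) (gam : YoungDiagram) (r : Fin p) :
    IsGreatest {x | x ∈ beads gam ∧ x ≡ (r : ℕ) [ZMOD p]} (lowestBead p gam r) := by
  have hbdd : BddAbove {x | x ∈ beads gam ∧ x ≡ (r : ℕ) [ZMOD p]} :=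
    ⟨gam.rowLen 0, fun x hx => le_of_mem_beads hx.1⟩
  have hne : {x | x ∈ beads gam ∧ x ≡ (r : ℕ) [ZMOD p]}.Nonempty := by
    -- A position on runner `r` far enough up to be occupied.
    refine ⟨(r : ℕ) - p * (gam.colLen 0 + 1 : ℕ), mem_beads_of_lt ?_, ?_⟩
    · have hr := r.2
      have : (gam.colLen 0 : ℤ) ≤ p * gam.colLen 0 := by
        have : gam.colLen 0 ≤ p * gam.colLen 0 := Nat.le_mul_of_pos_left _ hp
        exact_mod_cast this
      push_cast
      rw [mul_add]
      omega
    · exact (Int.modEq_iff_dvd.2 ⟨(gam.colLen 0 + 1 : ℕ), by ring⟩)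
  exact ⟨Int.csSup_mem hne hbdd, fun x hx => le_csSup hbdd hx⟩

theorem lowestBead_injective {p : ℕ} (hp : 0 < p) (gam : YoungDiagram) :
    Function.Injective (lowestBead p gam) := by
  intro r s h
  have hr := (lowestBead_isGreatest hp gam r).1.2
  have hs := (lowestBead_isGreatest hp gam s).1.2
  rw [h] at hr
  have := hr.symm.trans hs
  rw [Int.natCast_modEq_iff] at this
  exact Fin.ext (Nat.ModEq.eq_of_lt_of_lt this r.2 s.2)

theorem rho_lt_rho {p : ℕ} (gam : YoungDiagram) {i j : ℕ} (hij : i < j) (hj : j < p) :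
    rho p gam i < rho p gam j := by
  have hmono := Tuple.monotone_sort (lowestBead p gam)
  have hinj := (lowestBead_injective (by omega) gam).comp (Tuple.sort (lowestBead p gam)).injective
  have hi : i < p := hij.trans hj
  simp only [rho, hi, hj, dif_pos]
  exact hmono.strictMono_of_injective hinj (Fin.mk_lt_mk.2 hij)

theorem rho_le_rho {p : ℕ} (gam : YoungDiagram) {i j : ℕ} (hij : i ≤ j) (hj : j < p) :
    rho p gam i ≤ rho p gam j := by
  rcases hij.eq_or_lt with rfl | h
  · exact le_rfl
  · exact (rho_lt_rho gam h hj).le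

theorem le_of_rho_le_rho {p : ℕ} (gam : YoungDiagram) {i j : ℕ} (hi : i < p)
    (h : rho p gam i ≤ rho p gam j) : i ≤ j := by
  by_contra hlt
  exact (rho_lt_rho gam (not_le.1 hlt) hi).not_ge h

theorem rho_mem_beads {p : ℕ} (gam : YoungDiagram) {i : ℕ} (hi : i < p) :
    rho p gam i ∈ beads gam := by
  simp only [rho, hi, dif_pos]
  exact (lowestBead_isGreatest (by omega) gam _).1.1

theorem rho_add_mul_notMem_beads {p : ℕ} (gam : YoungDiagram) {i m : ℕ} (hi : i < p)
    (hm : 0 < m) : rho p gam i + m * p ∉ beads gam := by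
  intro hmem
  have hgreatest := lowestBead_isGreatest (by omega) gam
    (Tuple.sort (lowestBead p gam) ⟨i, hi⟩)
  have hrho : rho p gam i = lowestBead p gam (Tuple.sort (lowestBead p gam) ⟨i, hi⟩) := by
    simp only [rho, hi, dif_pos]
  rw [hrho] at hmem
  have hle := hgreatest.2 ⟨hmem, (Int.modEq_iff_dvd.2 ⟨-m, by ring⟩ : _ ≡ _ [ZMOD p]).trans
    hgreatest.1.2⟩
  have : 0 < m * p := Nat.mul_pos hm (by omega)
  have : (0 : ℤ) < m * p := by exact_mod_cast this
  omega

/-- The left position is vacant and the right one occupied. -/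
theorem rho_add_ne_rho {p : ℕ} (gam : YoungDiagram) {i j : ℕ} (hi : i < p) (hj : j < p) :
    rho p gam i + p ≠ rho p gam j := by
  intro h
  apply rho_add_mul_notMem_beads gam hi one_pos
  rw [Nat.cast_one, one_mul, h]
  exact rho_mem_beads gam hj

/-! ### The three kinds of names as pairs of moves -/

theorem isShift_pair {p : ℕ} {gam lam : YoungDiagram} {i j : ℕ} (hij : i < j) (hj : j < p)
    (h : beads lam = (Name.pair i j).beads p gam) :
    IsShift p gam lam (rho p gam i) (rho p gam j) := by
  classical
  intro f x
  have hlt := rho_lt_rho gam hij hj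
  have hi' := rho_mem_beads gam (hij.trans hj)
  have hj' := rho_mem_beads gam hj
  have hip := rho_add_mul_notMem_beads gam (hij.trans hj) one_pos
  have hjp := rho_add_mul_notMem_beads gam hj one_pos
  rw [Nat.cast_one, one_mul] at hip hjp
  rw [h]
  simp only [Name.beads, Set.indicator_apply, Set.mem_union, Set.mem_sdiff, Set.mem_insert_iff,
    Set.mem_singleton_iff]
  grind

/-- The intermediate position is filled by one move and vacated by the other, so its terms cancel.
-/
theorem isShift_single {p : ℕ} {gam lam : YoungDiagram} {i : ℕ} (hi : i < p)
    (h : beads lam = (Name.single i).beads p gam) :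
    IsShift p gam lam (rho p gam i) (rho p gam i + p) := by
  classical
  intro f x
  have hi' := rho_mem_beads gam hi
  have hip := rho_add_mul_notMem_beads gam hi two_pos
  rw [Nat.cast_ofNat] at hip
  rw [h]
  simp only [Name.beads, Set.indicator_apply, Set.mem_union, Set.mem_sdiff,
    Set.mem_singleton_iff]
  grind

/-- The number of beads below a position far enough up the abacus does not depend on the
partition; so an abacus cannot be obtained from another one by inserting a bead. -/
theorem beads_ne_insert {gam lam : YoungDiagram} {y : ℤ} (hy : y ∉ beads gam) :
    beads lam ≠ insert y (beads gam) := by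
  classical
  intro h
  obtain ⟨N, hNlam, hNgam, hNy⟩ : ∃ N : ℕ, lam.colLen 0 ≤ N ∧ gam.colLen 0 ≤ N ∧ -(N : ℤ) ≤ y :=
    ⟨lam.colLen 0 + gam.colLen 0 + y.natAbs, by omega, by omega, by omega⟩
  have hylam := le_of_mem_beads (show y ∈ beads lam from h ▸ Set.mem_insert _ _)
  -- Counts beads at positions at least `-N`; both partitions have exactly `N` of them.
  let f : ℤ → ℤ := fun x => if x ≤ -(N : ℤ) - 1 then 0 else 1
  have hf : ∀ x ≤ -(N : ℤ) - 1, f x = 0 := fun x hx => if_pos hx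
  have hM : ∀ x ∈ beads lam, x ≤ lam.rowLen 0 := fun x hx => le_of_mem_beads hx
  have hcount : ∀ nu : YoungDiagram, nu.colLen 0 ≤ N → (∀ x ∈ beads nu, x ≤ lam.rowLen 0) →
      ∑ x ∈ Finset.Icc (-(N : ℤ) - 1 + 1) (lam.rowLen 0), (beads nu).indicator f x = N := by
    intro nu hnu hM
    rw [← sum_bead_eq_sum_indicator nu f hf hM (N := N)]
    · rw [Finset.sum_congr rfl (g := fun _ => (1 : ℤ))]
      · simp
      · intro i hi
        have := Finset.mem_range.1 hi
        simp only [f, bead]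
        exact if_neg (by omega)
    · intro i hi
      rw [bead, rowLen_eq_zero_of_le (hnu.trans hi)]
      omega
  have hsum : ∑ x ∈ Finset.Icc (-(N : ℤ) - 1 + 1) (lam.rowLen 0), (beads lam).indicator f x =
      ∑ x ∈ Finset.Icc (-(N : ℤ) - 1 + 1) (lam.rowLen 0),
        ((beads gam).indicator f x + if x = y then 1 else 0) := by
    refine Finset.sum_congr rfl fun x hx => ?_
    have := (Finset.mem_Icc.1 hx).1
    have hfx : f x = 1 := if_neg (by omega)
    simp only [h, Set.indicator_apply, Set.mem_insert_iff, hfx]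
    grind
  rw [hcount lam hNlam hM, Finset.sum_add_distrib,
    hcount gam hNgam fun x hx => hM x (h ▸ Set.mem_insert_of_mem _ hx),
    Finset.sum_ite_eq', if_pos (Finset.mem_Icc.2 ⟨by omega, hylam⟩)] at hsum
  omega

theorem isShift_square {p : ℕ} {gam lam : YoungDiagram} {i : ℕ} (hi : i < p)
    (h : beads lam = (Name.square i).beads p gam) :
    IsShift p gam lam (rho p gam i - p) (rho p gam i) := by
  classical
  have hi' := rho_mem_beads gam hi
  have hip := rho_add_mul_notMem_beads gam hi one_pos
  rw [Nat.cast_one, one_mul] at hip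
  -- Otherwise the name would add a bead without removing one.
  have him : rho p gam i - p ∈ beads gam := by
    by_contra hnot
    refine beads_ne_insert hip (lam := lam) ?_
    rw [h]
    ext x
    simp only [Name.beads, Set.mem_union, Set.mem_sdiff, Set.mem_insert_iff,
      Set.mem_singleton_iff]
    grind
  intro f x
  rw [h]
  simp only [Name.beads, Set.indicator_apply, Set.mem_union, Set.mem_sdiff, Set.mem_insert_iff,
    Set.mem_singleton_iff]
  grind

/-! ### Pyramid positions and the final comparison -/

theorem pyramid_eq_zero_iff {p : ℕ} {gam : YoungDiagram} {i j : ℕ} (hij : i ≤ j) :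
    pyramid p gam i j = 0 ↔ (j < p → p ≤ rho p gam j - rho p gam i) := by
  unfold pyramid
  grind

/-- A description of the two moves leading from the core to the partition `⌈i,j⌋`. -/
theorem HasPosition.exists_isShift {p : ℕ} {gam lam : YoungDiagram} {i j : ℕ}
    (h : HasPosition p gam lam i j) :
    ∃ a b, a ≤ b ∧ IsShift p gam lam a b ∧
      ((i = j ∧ a = rho p gam (i + 1)) ∨
      (i < j ∧ p ≤ rho p gam j - rho p gam i ∧ rho p gam i ≤ a ∧ a ≤ rho p gam (i + 1) ∧
        (a = rho p gam (i + 1) ∨ a = rho p gam j - p) ∧ b = rho p gam j) ∨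
      (i < j ∧ rho p gam j - rho p gam i < p ∧ a = rho p gam i ∧ rho p gam j < b ∧
        b ≤ rho p gam i + p ∧ (j + 1 < p → b ≤ rho p gam (j + 1)))) := by
  obtain ⟨hij, hj, hi, hbeads⟩ := h
  unfold regularName at hbeads
  rcases hij.eq_or_lt with rfl | hlt
  · rw [if_pos rfl] at hbeads
    split_ifs at hbeads with h₁
    · exact ⟨_, _, by omega, isShift_single hi hbeads, Or.inl ⟨rfl, rfl⟩⟩
    · rw [pyramid_eq_zero_iff (by omega)] at h₁
      push Not at h₁
      exact ⟨_, _, rho_le_rho gam (by omega) h₁.1, isShift_pair (by omega) h₁.1 hbeads,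
        Or.inl ⟨rfl, rfl⟩⟩
  · have hstep := rho_lt_rho gam (Nat.lt_succ_self i) hi
    have hle := rho_le_rho gam (show i + 1 ≤ j from hlt) hj
    have hnext := fun hj' : j + 1 < p => rho_lt_rho gam (Nat.lt_succ_self j) hj'
    simp only [Nat.succ_eq_add_one] at hstep hnext
    simp only [if_neg hlt.ne, pyramid_eq_zero_iff (show i + 1 ≤ j from hlt),
      pyramid_eq_zero_iff hlt.le, pyramid_eq_zero_iff (show i ≤ j + 1 by omega)] at hbeads
    split_ifs at hbeads with h₁ h₂ h₃
    · have := h₁ hj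
      have hne : i + 1 ≠ j := by
        rintro rfl
        omega
      exact ⟨_, _, hle, isShift_pair (by omega) hj hbeads, Or.inr (Or.inl
        ⟨hlt, by omega, hstep.le, le_rfl, Or.inl rfl, rfl⟩)⟩
    · have := h₂ hj
      push Not at h₁
      exact ⟨_, _, by omega, isShift_square hj hbeads, Or.inr (Or.inl
        ⟨hlt, this, by omega, by omega, Or.inr rfl, rfl⟩)⟩
    -- The entry at `(i, j + 1)` is also zero by convention when `j + 1 = p`, so the bound by `rho p
    -- gam (j + 1)` is conditional.
    · push Not at h₂
      exact ⟨_, _, by omega, isShift_single (by omega) hbeads, Or.inr (Or.inr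
        ⟨hlt, h₂.2, rfl, by omega, le_rfl, fun hj' => by have := h₃ hj'; omega⟩)⟩
    · push Not at h₂ h₃
      have := hnext h₃.1
      exact ⟨_, _, by omega, isShift_pair (by omega) h₃.1 hbeads, Or.inr (Or.inr
        ⟨hlt, h₂.2, rfl, this, by omega, fun _ => le_rfl⟩)⟩

theorem HasPosition.not_dominatedBy {p : ℕ} {gam lam tau : YoungDiagram} {i j k l : ℕ}
    (hij : HasPosition p gam lam i j) (hkl : HasPosition p gam tau k l)
    (hleft : i + j < k + l) (hrow : i = j → k = l) : ¬ (tau ⊴ᵈ lam) := by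
  intro hdom
  obtain ⟨a, b, hab, hlam, hposlam⟩ := hij.exists_isShift
  obtain ⟨c, d, hcd, htau, hpostau⟩ := hkl.exists_isShift
  obtain ⟨-, hj, hi, -⟩ := hij
  obtain ⟨-, hl, hk, -⟩ := hkl
  obtain ⟨hca, hdb⟩ := hlam.le_of_dominatedBy (by omega) htau hab hcd hdom
  rcases hposlam with ⟨rfl, rfl⟩ | ⟨hlt, hfar, hia, hai, -, rfl⟩ | ⟨hlt, hnear, rfl, hjb, hbi, hbj⟩
  · obtain rfl := hrow rfl
    rcases hpostau with ⟨-, rfl⟩ | h | h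
    · have := le_of_rho_le_rho gam hk hca
      omega
    · omega
    · omega
  · rcases hpostau with ⟨rfl, rfl⟩ | ⟨hlt', -, hkc, -, hc, rfl⟩ | ⟨hlt', -, rfl, hld, -, -⟩
    · have := le_of_rho_le_rho gam hk (hca.trans hai)
      omega
    · have hlj := le_of_rho_le_rho gam hl hdb
      have hki := le_of_rho_le_rho gam (by omega) (hkc.trans (hca.trans hai))
      -- Here `l = j` as well; the only way out, `c = rho p gam l - p`, squeezes `c` to `rho p gam
      -- k`.
      obtain rfl : k = i + 1 := by omega
      rcases hc with rfl | rfl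
      · have := le_of_rho_le_rho gam hk (hca.trans hai)
        omega
      · exact rho_add_ne_rho gam hi hl (by omega)
    · have hki := le_of_rho_le_rho gam (by omega) (hca.trans hai)
      have hjl : j ≤ l := by omega
      have := rho_le_rho gam hjl hl
      omega
  · rcases hpostau with ⟨rfl, rfl⟩ | ⟨hlt', hfar, hkc, -, -, rfl⟩ | ⟨hlt', -, rfl, hld, -, -⟩
    · have := le_of_rho_le_rho gam hk hca
      omega
    · have hki := le_of_rho_le_rho gam (by omega) (hkc.trans hca)
      have hlj := le_of_rho_le_rho gam hl (hdb.trans (hbj (by omega)))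
      -- Now `l = j + 1`, and `b ≤ rho p gam i + p` together with `hfar` gives distance exactly `p`.
      obtain rfl : k = i := by omega
      exact rho_add_ne_rho gam (by omega : k < p) hl (by omega)
    · have hki := le_of_rho_le_rho gam (by omega) hca
      have := rho_le_rho gam (show j + 1 ≤ l by omega) hl
      have := hbj (by omega)
      omega

end WeightTwo

theorem mainTheorem6 (p : ℕ) (hp : p.Prime) (hp2 : p ≠ 2)
    (gam : YoungDiagram) (hgam : IsCore p gam)
    (lam tau : YoungDiagram)
    (hlam : lam ∈ regularBlock p gam 2) (htau : tau ∈ regularBlock p gam 2)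
    (i j k l : ℕ) (hij : HasPosition p gam lam i j) (hkl : HasPosition p gam tau k l)
    (hleft : i + j < k + l)
    (hrow : i = j → k = l) :
    ¬ (tau ◁ᵈ lam) ∧
      (lam ⊴ᵈ tau ∨ (¬ (lam ⊴ᵈ tau) ∧ ¬ (tau ⊴ᵈ lam))) := by
  have hnot : ¬ (tau ⊴ᵈ lam) := hij.not_dominatedBy hkl hleft hrow
  refine ⟨fun h => hnot h.1, ?_⟩
  by_cases h : lam ⊴ᵈ tau
  · exact Or.inl h
  · exact Or.inr ⟨h, hnot⟩
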